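/- Let $R$ be a left Ore domain (for instance an Ore domain), $S=R\setminus\{0\}$, and let $S^{-1}R$ be its division ring of left fractions. Let $0\le r\le n$, let $Q=(q_{ij})\in \mathrm{Mat}_n(R)$ satisfy $q_{ii}=1=q_{ij}q_{ji}$ for all $1\le i,j\le n$, and let $\sigma_1,\dots,\sigma_n$ be ring automorphisms of $R$. Let $\mathcal O_{Q,\sigma}=R_{Q,\sigma}[x_1^{\pm1},\dots,x_r^{\pm1},x_{r+1},\dots,x_n]$ be a ring of skew quantum polynomials over $R$, that is, a ring containing $R$ and elements $x_1,\dots,x_n$ such that: $x_1,\dots,x_r$ are invertible; $\mathcal O_{Q,\sigma}$ is a free left $R$-module with basis the monomials $x_1^{t_1}\cdots x_n^{t_n}$ with $t_i\in\mathbb Z$ for $i\le r$ and $t_i\in\mathbb N$ for $i>r$; $x_jx_i=q_{ji}x_ix_j$ for all $i,j$; and $x_ia=\sigma_i(a)x_i$ for all $a\in R$ and all $i$. Let $\overline{\sigma_i}$ be the automorphism of $S^{-1}R$ induced by $\sigma_i$, and let $N$ be the subgroup of $(S^{-1}R)^*$ generated by the derived subgroup $[(S^{-1}R)^*,(S^{-1}R)^*]$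 and all elements $z^{-1}\overline{\sigma_i}(z)$ with $z\in(S^{-1}R)^*$, $1\le i\le n$. Assume that the images of the $q_{ij}$, $1\le i<j\le n$, in the abelian group $(S^{-1}R)^*/N$ are independent, i.e. $\prod_{i<j}q_{ij}^{m_{ij}}\in N$ with $m_{ij}\in\mathbb Z$ only if all $m_{ij}=0$. Let $\lambda$ be a ring endomorphism of $\mathcal O_{Q,\sigma}$ with $\lambda(a)=a$ for all $a\in R$, and suppose that there are at least three distinct indices $i,j,u$ with $\lambda(x_i),\lambda(x_j),\lambda(x_u)\neq0$. Then there are $\lambda_1,\dots,\lambda_n\in R$ and a single $\epsilon\in\{1,-1\}$ such that $$\lambda(x_w)=\lambda_wx_w^{\epsilon}\qquad\text{for all } w=1,\dots,n,$$ where, if $\epsilon=-1$, for $w>r$ (when $x_w^{-1}$ does not exist in $\mathcal O_{Q,\sigma}$) the equality means $\lambda_w=0$ and $\lambda(x_w)=0$. -/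

import Mathlib

open scoped nonZeroDivisors

namespace SkewQuantum

/-! ### The subgroup `N` and the abelian quotient -/

section Groups

variable {ι G : Type*} [Group G]

/-- For a family `τ` of endomorphisms of a group `G`: the subgroup generated by the derived subgroup
`[G, G]` and all the elements `z⁻¹ τᵢ(z)`. -/
def twistSubgroup (τ : ι → G →* G) : Subgroup G :=
  commutator G ⊔ Subgroup.closure {g : G | ∃ (i : ι) (z : G), g = z⁻¹ * τ i z}

theorem commutator_le_twistSubgroup (τ : ι → G →* G) : commutator G ≤ twistSubgroup τ :=
  le_sup_left

instance twistSubgroup_normal (τ : ι → G →* G) : (twistSubgroup τ).Normal :=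
  Subgroup.Normal.of_commutator_le G (commutator_le_twistSubgroup τ)

/-- The quotient by a subgroup that contains the derived subgroup is an abelian group. -/
instance twistQuotientCommGroup (τ : ι → G →* G) : CommGroup (G ⧸ twistSubgroup τ) :=
  { (inferInstance : Group (G ⧸ twistSubgroup τ)) with
    mul_comm :=
      (Subgroup.Normal.quotient_commutative_iff_commutator_le.mpr
        (commutator_le_twistSubgroup τ)).is_comm.comm }

end Groups

/-! ### The ring of left fractions of a left Ore domain -/

section Fractions

variable (R : Type*) [Ring R] [IsDomain R] [OreLocalization.OreSet R⁰]

/-- The division ring `S⁻¹R` of left fractions, where `S = R \ {0}`. -/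
abbrev Frac : Type _ := OreLocalization R⁰ R

variable {R}

/-- A nonzero element `s` of `R`, as the unit `s / 1` of `S⁻¹R`. -/
def fracUnit : R⁰ →* (Frac R)ˣ where
  toFun := OreLocalization.numeratorUnit
  map_one' := Units.ext (map_one (OreLocalization.numeratorHom (S := R⁰)))
  map_mul' s t := Units.ext (map_mul (OreLocalization.numeratorHom (S := R⁰)) (s : R) (t : R))

/-- An automorphism of `R` maps `S = R \ {0}` to itself. -/
def nonzeroMap (σ : R ≃+* R) : R⁰ →* R⁰ where
  toFun s := ⟨σ s, mem_nonZeroDivisors_of_ne_zero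
    ((map_ne_zero_iff σ σ.injective).mpr (nonZeroDivisors.ne_zero s.2))⟩
  map_one' := Subtype.ext (map_one σ)
  map_mul' s t := Subtype.ext (map_mul σ (s : R) (t : R))

/-- The endomorphism `σ̄` of `S⁻¹R` induced by an automorphism `σ` of `R`:
`σ̄ (s⁻¹ a) = σ(s)⁻¹ σ(a)`. -/
def fracMap (σ : R ≃+* R) : Frac R →+* Frac R :=
  OreLocalization.universalHom
    ((OreLocalization.numeratorRingHom (S := R⁰)).comp (σ : R →+* R))
    (fracUnit.comp (nonzeroMap σ)) (fun _ => rfl)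

end Fractions

/-! ### Skew quantum polynomial rings -/

section SkewQuantumPolynomials

/-- `a ^ m` for an integer `m`; for `m < 0` this is meant for a unit `a` (it is `0` when `a` is not
a unit). -/
noncomputable def intPow {O : Type*} [Ring O] (a : O) : ℤ → O
  | Int.ofNat k => a ^ k
  | Int.negSucc k => Ring.inverse a ^ (k + 1)

/-- The exponents: `t ∈ ℤⁿ` such that only the first `r` entries may be negative. -/
def Exponent (n r : ℕ) : Type := {t : Fin n → ℤ // ∀ i : Fin n, r ≤ (i : ℕ) → 0 ≤ t i}

/-- The monomial `x₁^{t₁} ⋯ xₙ^{tₙ}`. -/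
noncomputable def monomial {O : Type*} [Ring O] {n r : ℕ} (x : Fin n → O) (t : Exponent n r) : O :=
  (List.ofFn fun i => intPow (x i) (t.1 i)).prod

/-- A matrix of parameters: `q_{ii} = 1 = q_{ij} q_{ji}`. -/
structure IsParameterMatrix {R : Type*} [Ring R] {n : ℕ} (q : Matrix (Fin n) (Fin n) R) : Prop where
  diag : ∀ i, q i i = 1
  mul_swap : ∀ i j, q i j * q j i = 1

/-- The parameter `q_{ij}` as a unit of `R`. -/
def IsParameterMatrix.unit {R : Type*} [Ring R] {n : ℕ} {q : Matrix (Fin n) (Fin n) R}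
    (hq : IsParameterMatrix q) (i j : Fin n) : Rˣ :=
  ⟨q i j, q j i, hq.mul_swap i j, hq.mul_swap j i⟩

/-- The ring `O`, which contains `R` through `a ↦ a • 1`, is the ring of skew quantum polynomials
`R_{q,σ}[x₁^{±1}, …, x_r^{±1}, x_{r+1}, …, xₙ]` in the elements `x₁, …, xₙ`
(with indices starting at `0` in `Fin n`). -/
structure IsSkewQuantumPolynomialRing {R O : Type*} [Ring R] [Ring O] [Module R O]
    [IsScalarTower R O O] {n : ℕ} (r : ℕ) (q : Matrix (Fin n) (Fin n) R) (σ : Fin n → R ≃+* R)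
    (x : Fin n → O) : Prop where
  le : r ≤ n
  param : IsParameterMatrix q
  coeff_injective : Function.Injective (RingHom.smulOneHom : R →+* O)
  isUnit : ∀ i : Fin n, (i : ℕ) < r → IsUnit (x i)
  linearIndependent : LinearIndependent R fun t : Exponent n r => monomial x t
  span_eq_top : Submodule.span R (Set.range fun t : Exponent n r => monomial x t) = ⊤
  mul_var : ∀ i j, x j * x i = q j i • (x i * x j)
  mul_coeff : ∀ (i : Fin n) (a : R), x i * (a • (1 : O)) = σ i a • x i

/-- The subgroup `N` of `(S⁻¹R)ˣ` generated by the derived subgroup and the elements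
`z⁻¹ σ̄ᵢ(z)`. -/
abbrev fracN {R : Type*} [Ring R] [IsDomain R] [OreLocalization.OreSet R⁰] {n : ℕ}
    (σ : Fin n → R ≃+* R) : Subgroup (Frac R)ˣ :=
  twistSubgroup fun i : Fin n => Units.map (fracMap (σ i) : Frac R →* Frac R)

/-- The image of the parameter `q_{ij}` in the abelian group `(S⁻¹R)ˣ / N`. -/
def paramClass {R : Type*} [Ring R] [IsDomain R] [OreLocalization.OreSet R⁰] {n : ℕ}
    {q : Matrix (Fin n) (Fin n) R} (hq : IsParameterMatrix q) (σ : Fin n → R ≃+* R)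
    (i j : Fin n) : (Frac R)ˣ ⧸ fracN σ :=
  QuotientGroup.mk
    (Units.map (OreLocalization.numeratorRingHom (S := R⁰) : R →* Frac R) (hq.unit i j))

/-- The images of the `q_{ij}`, `i < j`, in `(S⁻¹R)ˣ / N` are (multiplicatively) independent:
a product of integer powers of them is trivial only if all the exponents vanish. -/
def ParamsIndependent {R : Type*} [Ring R] [IsDomain R] [OreLocalization.OreSet R⁰] {n : ℕ}
    {q : Matrix (Fin n) (Fin n) R} (hq : IsParameterMatrix q) (σ : Fin n → R ≃+* R) : Prop :=
  LinearIndependent ℤ fun p : {p : Fin n × Fin n // p.1 < p.2} =>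
    Additive.ofMul (paramClass hq σ p.1.1 p.1.2)

end SkewQuantumPolynomials

end SkewQuantum

/-! Since `φ` fixes `R`, the images `f i = φ (x i)` satisfy the same relations `f i * f j = q i j •
(f j * f i)`. Order the exponents by a total group order and compare the leading coefficients of
both sides. In the abelian group `(S⁻¹R)ˣ / N` the twists by the `σ i` and the leading coefficients
cancel, leaving an equation between powers of the `q a b`; by independence the leading exponents
`s`, `t` of `f i`, `f j` satisfy `s ∧ t = e_i ∧ e_j` (`prod_zpow_of_isLeading`,
`wedge_eq_of_isLeading`). Three nonzero images force every leading exponent to be `ε e_w` with one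
common sign (`exists_sign_of_wedge_eq`).

This holds for every lexicographic order twisted by signs. The order and its reverse give the
largest and the smallest exponent of `f w`. If their signs agree, `f w` has a single monomial; if
not, an order with one coordinate flipped gives a contradiction (`exists_sign_forall_support`).

The quotient with a zero adjoined enters only as a map `κ` from `R` to a commutative group with
zero; `fracClass` is the instance needed. -/

namespace SkewQuantum

/-! ### Commutation of monomials up to units, tracked by `κ`. -/

section Commutation

variable {R O Γ : Type*} [Ring R] [Ring O] [Module R O] [CommGroupWithZero Γ]
  {κ : R →*₀ Γ}

/-- Left multiplication by `y` is semilinear for an automorphism of `R` that preserves `κ`. -/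
def Normalizes (κ : R →*₀ Γ) (y : O) : Prop :=
  ∃ τ : R ≃+* R, (∀ a, κ (τ a) = κ a) ∧ ∀ (a : R) (z : O), y * (a • z) = τ a • (y * z)

/-- `y` and `z` commute up to a unit of `R` whose value under `κ` is `g`. -/
def QCommute (κ : R →*₀ Γ) (y z : O) (g : Γ) : Prop :=
  ∃ a : Rˣ, κ a = g ∧ y * z = (a : R) • (z * y)

namespace Normalizes

theorem one : Normalizes κ (1 : O) := ⟨RingEquiv.refl R, fun _ => rfl, fun a z => by simp⟩

theorem mul {y z : O} (hy : Normalizes κ y) (hz : Normalizes κ z) : Normalizes κ (y * z) := by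
  obtain ⟨τ, hτ, h⟩ := hy
  obtain ⟨τ', hτ', h'⟩ := hz
  refine ⟨τ'.trans τ, fun a => ?_, fun a w => ?_⟩
  · simp [hτ, hτ']
  · simp [mul_assoc, h, h']

theorem pow {y : O} (hy : Normalizes κ y) (k : ℕ) : Normalizes κ (y ^ k) := by
  induction k with
  | zero => simpa using one
  | succ k ih => rw [pow_succ]; exact ih.mul hy

theorem units_inv {u : Oˣ} (hu : Normalizes κ (u : O)) : Normalizes κ ((u⁻¹ : Oˣ) : O) := by
  obtain ⟨τ, hτ, h⟩ := hu
  refine ⟨τ.symm, fun a => ?_, fun a z => ?_⟩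
  · rw [← hτ, τ.apply_symm_apply]
  · rw [Units.inv_mul_eq_iff_eq_mul, h, τ.apply_symm_apply, Units.mul_inv_cancel_left]

theorem intPow {y : O} (hy : Normalizes κ y) {k : ℤ} (hk : IsUnit y ∨ 0 ≤ k) :
    Normalizes κ (intPow y k) := by
  cases k with
  | ofNat k => exact hy.pow k
  | negSucc k =>
    obtain ⟨u, rfl⟩ := hk.resolve_right (by simp)
    simpa [SkewQuantum.intPow] using hy.units_inv.pow (k + 1)

theorem list_prod {l : List O} (h : ∀ y ∈ l, Normalizes κ y) : Normalizes κ l.prod := by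
  induction l with
  | nil => simpa using one
  | cons y l ih =>
    rw [List.prod_cons]
    exact (h y (by simp)).mul (ih fun z hz => h z (by simp [hz]))

end Normalizes

namespace QCommute

variable {y y' z : O} {g g' : Γ}

theorem symm (h : QCommute κ y z g) : QCommute κ z y g⁻¹ := by
  obtain ⟨a, rfl, h⟩ := h
  refine ⟨a⁻¹, ?_, ?_⟩
  · exact eq_inv_of_mul_eq_one_left (by rw [← map_mul]; simp)
  · rw [h, smul_smul]; simp

theorem one_left : QCommute κ (1 : O) z 1 := ⟨1, by simp, by simp⟩

variable [IsScalarTower R O O]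

theorem mul_left (hy : Normalizes κ y) (h : QCommute κ y z g) (h' : QCommute κ y' z g') :
    QCommute κ (y * y') z (g * g') := by
  obtain ⟨a, rfl, h⟩ := h
  obtain ⟨b, rfl, h'⟩ := h'
  obtain ⟨τ, hτ, hy⟩ := hy
  refine ⟨Units.map (τ : R →* R) b * a, ?_, ?_⟩
  · simp [hτ, mul_comm]
  · rw [mul_assoc, h', hy, ← mul_assoc, h, smul_mul_assoc, smul_smul, mul_assoc]
    simp

theorem units_inv_left {u : Oˣ} (hu : Normalizes κ (u : O)) (h : QCommute κ (u : O) z g) :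
    QCommute κ ((u⁻¹ : Oˣ) : O) z g⁻¹ := by
  obtain ⟨a, rfl, h⟩ := h
  obtain ⟨τ, hτ, hu⟩ := hu.units_inv
  refine symm ⟨Units.map (τ : R →* R) a, by simp [hτ], ?_⟩
  have := congrArg (fun w => ((u⁻¹ : Oˣ) : O) * w * ((u⁻¹ : Oˣ) : O)) h
  simpa [hu, mul_assoc, smul_mul_assoc] using this

theorem pow_left (hy : Normalizes κ y) (h : QCommute κ y z g) (k : ℕ) :
    QCommute κ (y ^ k) z (g ^ k) := by
  induction k with
  | zero => simpa using one_left
  | succ k ih => rw [pow_succ, pow_succ]; exact mul_left (hy.pow k) ih h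

theorem intPow_left (hy : Normalizes κ y) (h : QCommute κ y z g) {k : ℤ}
    (hk : IsUnit y ∨ 0 ≤ k) : QCommute κ (intPow y k) z (g ^ k) := by
  cases k with
  | ofNat k => simpa using! h.pow_left hy k
  | negSucc k =>
    obtain ⟨u, rfl⟩ := hk.resolve_right (by simp)
    simpa [SkewQuantum.intPow] using (h.units_inv_left hy).pow_left hy.units_inv (k + 1)

theorem intPow_right (hz : Normalizes κ z) (h : QCommute κ y z g) {k : ℤ}
    (hk : IsUnit z ∨ 0 ≤ k) : QCommute κ y (intPow z k) (g ^ k) := by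
  simpa using (h.symm.intPow_left hz hk).symm

theorem ofFn_prod_left {n : ℕ} {y : Fin n → O} {g : Fin n → Γ} (hy : ∀ i, Normalizes κ (y i))
    (h : ∀ i, QCommute κ (y i) z (g i)) : QCommute κ (List.ofFn y).prod z (∏ i, g i) := by
  induction n with
  | zero => simpa using one_left
  | succ n ih =>
    rw [List.ofFn_succ, List.prod_cons, Fin.prod_univ_succ]
    exact mul_left (hy 0) (h 0) (ih (fun i => hy i.succ) fun i => h i.succ)

theorem ofFn_prod_right {n : ℕ} {z : Fin n → O} {g : Fin n → Γ} (hz : ∀ i, Normalizes κ (z i))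
    (h : ∀ i, QCommute κ y (z i) (g i)) : QCommute κ y (List.ofFn z).prod (∏ i, g i) := by
  simpa using (ofFn_prod_left hz fun i => (h i).symm).symm

end QCommute

/-- Each `z 0` is moved left past the later `y i`. Pulling the resulting scalars to the front only
applies automorphisms of `R`, so they stay units. -/
theorem ofFn_prod_mul_ofFn_prod [IsScalarTower R O O] {n : ℕ} {y z : Fin n → O} {g : Fin n → Fin n → Γ}
    (hy : ∀ i, Normalizes κ (y i)) (hz : ∀ i, Normalizes κ (z i))
    (h : ∀ i j, QCommute κ (y i) (z j) (g i j)) :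
    ∃ a : Rˣ, (List.ofFn y).prod * (List.ofFn z).prod =
      (a : R) • (List.ofFn fun i => y i * z i).prod := by
  induction n with
  | zero => exact ⟨1, by simp⟩
  | succ n ih =>
    obtain ⟨b, hb⟩ := ih (fun i => hy i.succ) (fun i => hz i.succ) fun i j => h i.succ j.succ
    obtain ⟨c, -, hc⟩ := QCommute.ofFn_prod_left (fun i => hy (Fin.succ i)) fun i => h i.succ 0
    obtain ⟨τ, -, hτ⟩ := hy 0
    obtain ⟨τ', -, hτ'⟩ := (hy 0).mul (hz 0)
    refine ⟨Units.map (τ : R →* R) c * Units.map (τ' : R →* R) b, ?_⟩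
    simp only [List.ofFn_succ, List.prod_cons]
    calc y 0 * (List.ofFn fun i : Fin n => y i.succ).prod *
          (z 0 * (List.ofFn fun i : Fin n => z i.succ).prod)
        = y 0 * ((List.ofFn fun i : Fin n => y i.succ).prod * z 0) *
          (List.ofFn fun i : Fin n => z i.succ).prod := by simp only [mul_assoc]
      _ = τ c • (y 0 * z 0 * ((List.ofFn fun i : Fin n => y i.succ).prod *
          (List.ofFn fun i : Fin n => z i.succ).prod)) := by
            rw [hc, hτ, smul_mul_assoc]; simp only [mul_assoc]
      _ = _ := by rw [hb, hτ', smul_smul]; simp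

/-- For a non-unit, `intPow` takes the default value `0` at negative exponents, hence the sign
conditions. -/
theorem intPow_add {y : O} {k l : ℤ} (h : IsUnit y ∨ 0 ≤ k ∧ 0 ≤ l) :
    intPow y (k + l) = intPow y k * intPow y l := by
  rcases h with ⟨u, rfl⟩ | ⟨hk, hl⟩
  · have key : ∀ m : ℤ, intPow (u : O) m = ((u ^ m : Oˣ) : O) := by
      intro m
      cases m with
      | ofNat m => simp [intPow]
      | negSucc m => simp [intPow, zpow_negSucc, ← inv_pow]
    simp only [key, zpow_add, Units.val_mul]
  · lift k to ℕ using hk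
    lift l to ℕ using hl
    exact pow_add y k l

theorem ofFn_prod_eq_single {M : Type*} [Monoid M] {n : ℕ} {y : Fin n → M} (w : Fin n)
    (h : ∀ i, i ≠ w → y i = 1) : (List.ofFn y).prod = y w := by
  induction n with
  | zero => exact w.elim0
  | succ n ih =>
    rw [List.ofFn_succ, List.prod_cons]
    induction w using Fin.cases with
    | zero =>
      simp [fun i : Fin n => h i.succ (Fin.succ_ne_zero i), List.ofFn_const]
    | succ w =>
      rw [h 0 (Fin.succ_ne_zero w).symm, one_mul,
        ih w fun i hi => h _ fun hh => hi (Fin.succ_injective _ hh)]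

end Commutation

/-! ### The leading coefficient of a product. -/

section LeadingCoefficient

/-- In a cancellative ordered monoid a sum of two upper bounds is attained only by the bounds
themselves, so a single pair of terms contributes. The bounds need not lie in the supports:
otherwise both sides vanish. -/
theorem repr_mul_apply_of_isMax {R O E Λ : Type*} [Ring R] [Ring O] [Module R O]
    [IsScalarTower R O O] [AddCommMonoid Λ] [LinearOrder Λ] [IsOrderedCancelAddMonoid Λ]
    (b : Module.Basis E R O) (add : E → E → E) (τ : E → R ≃+* R) (c : E → E → R)
    (hτ : ∀ s a z, b s * (a • z) = τ s a • (b s * z))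
    (hc : ∀ s t, b s * b t = c s t • b (add s t))
    (ℓ : E → Λ) (hℓ : Function.Injective ℓ) (hadd : ∀ s t, ℓ (add s t) = ℓ s + ℓ t)
    {y z : O} {s t : E} (hs : ∀ s' ∈ (b.repr y).support, ℓ s' ≤ ℓ s)
    (ht : ∀ t' ∈ (b.repr z).support, ℓ t' ≤ ℓ t) :
    b.repr (y * z) (add s t) = b.repr y s * τ s (b.repr z t) * c s t := by
  have hyz : y * z = ∑ s' ∈ (b.repr y).support, ∑ t' ∈ (b.repr z).support,
      (b.repr y s' * τ s' (b.repr z t') * c s' t') • b (add s' t') := by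
    conv_lhs => rw [← b.linearCombination_repr y, ← b.linearCombination_repr z]
    simp only [Finsupp.linearCombination_apply, Finsupp.sum, Finset.sum_mul, Finset.mul_sum,
      smul_mul_assoc, hτ, hc, smul_smul, mul_assoc]
    exact Finset.sum_comm
  have hne : ∀ s' ∈ (b.repr y).support, ∀ t' ∈ (b.repr z).support, add s' t' = add s t →
      s' = s ∧ t' = t := by
    intro s' hs' t' ht' h
    have h' := congrArg ℓ h
    rw [hadd, hadd] at h'
    have := (add_eq_add_iff_eq_and_eq (hs s' hs') (ht t' ht')).1 h'
    exact ⟨hℓ this.1, hℓ this.2⟩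
  classical
  rw [hyz]
  simp only [map_sum, map_smul, b.repr_self, Finsupp.coe_finsetSum, Finset.sum_apply,
    Finsupp.smul_apply, Finsupp.single_apply, smul_eq_mul]
  rw [Finset.sum_eq_single s, Finset.sum_eq_single t]
  · simp
  · intro t' ht' hne'
    by_cases hs' : s ∈ (b.repr y).support
    · rw [if_neg fun h => hne' (hne s hs' t' ht' h).2, mul_zero]
    · simp [Finsupp.notMem_support_iff.1 hs']
  · intro h; simp [Finsupp.notMem_support_iff.1 h]
  · intro s' hs' hne'
    refine Finset.sum_eq_zero fun t' ht' => ?_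
    rw [if_neg fun h => hne' (hne s' hs' t' ht' h).1, mul_zero]
  · intro h; simp [Finsupp.notMem_support_iff.1 h]

end LeadingCoefficient

/-! ### Sign-twisted orders and the integer linear algebra of exponents. -/

section Exponents

variable {n r : ℕ}

/-- The sum of two exponents. -/
def Exponent.add (s t : Exponent n r) : Exponent n r :=
  ⟨s.1 + t.1, fun i hi => add_nonneg (s.2 i hi) (t.2 i hi)⟩

/-- The lexicographic order on the exponents, twisted by the signs of the entries of `d`. -/
def Exponent.twistLex (d : Fin n → ℤ) (t : Exponent n r) : Lex (Fin n → ℤ) := toLex (d * t.1)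

theorem Exponent.twistLex_injective {d : Fin n → ℤ} (hd : ∀ i, d i ≠ 0) :
    Function.Injective (Exponent.twistLex d : Exponent n r → _) := by
  intro s t h
  refine Subtype.ext (funext fun i => ?_)
  exact mul_left_cancel₀ (hd i) (congrFun (toLex.injective h) i)

theorem Exponent.twistLex_add (d : Fin n → ℤ) (s t : Exponent n r) :
    Exponent.twistLex d (s.add t) = Exponent.twistLex d s + Exponent.twistLex d t :=
  congrArg toLex (mul_add d s.1 t.1)

theorem Exponent.le_of_twistLex_le {d : Fin n → ℤ} {s t : Exponent n r} {w : Fin n} {k l : ℤ}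
    (hs : s.1 = Pi.single w k) (ht : t.1 = Pi.single w l)
    (h : Exponent.twistLex d s ≤ Exponent.twistLex d t) : d w * k ≤ d w * l := by
  by_contra! hlt
  refine absurd h (not_le.2 (Pi.toLex_strictMono ?_))
  have key : ∀ m : ℤ, d * Pi.single w m = Pi.single w (d w * m) := fun m => by
    ext i
    by_cases hi : i = w
    · subst hi; simp
    · simp [hi]
  rw [hs, ht, key, key]
  exact Pi.single_strictMono w hlt

/-- Vectors in the plane of the `i`-th and the `j`-th unit vector are determined by their
wedge product. -/
theorem eq_zero_of_wedge_eq {ι : Type*} [DecidableEq ι] {i j : ι} {s t : ι → ℤ} (hij : i ≠ j)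
    (h : ∀ a b, s a * t b - s b * t a =
      (Pi.single i 1 : ι → ℤ) a * (Pi.single j 1 : ι → ℤ) b -
        (Pi.single i 1 : ι → ℤ) b * (Pi.single j 1 : ι → ℤ) a) :
    s i * t j - s j * t i = 1 ∧ ∀ a, a ≠ i → a ≠ j → s a = 0 ∧ t a = 0 := by
  have h1 : s i * t j - s j * t i = 1 := by simpa [hij, hij.symm] using h i j
  refine ⟨h1, fun a hi hj => ?_⟩
  have h2 : s i * t a - s a * t i = 0 := by simpa [hi, hj, hij, hij.symm] using h i a
  have h3 : s a * t j - s j * t a = 0 := by simpa [hi, hj, hij, hij.symm] using h a j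
  -- Cramer's rule: `h2` and `h3` form a linear system in `s a`, `t a` of determinant `±1`.
  constructor
  · linear_combination (-s a) * h1 + s i * h3 + s j * h2
  · linear_combination (-t a) * h1 + t j * h2 + t i * h3

/-- Each `m w` lies in the plane of `e_w` and `e_v` for every other `v ∈ Z`. For `a ≠ w`, three
indices leave a `v` different from both, so `m w a = 0`. The diagonal entries then have pairwise
product `1`. -/
theorem exists_sign_of_wedge_eq {ι : Type*} [DecidableEq ι] (Z : Set ι)
    (hZ : ∃ i ∈ Z, ∃ j ∈ Z, ∃ u ∈ Z, i ≠ j ∧ i ≠ u ∧ j ≠ u) (m : ι → ι → ℤ)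
    (h : ∀ i ∈ Z, ∀ j ∈ Z, i ≠ j → ∀ a b, m i a * m j b - m i b * m j a =
      (Pi.single i 1 : ι → ℤ) a * (Pi.single j 1 : ι → ℤ) b -
        (Pi.single i 1 : ι → ℤ) b * (Pi.single j 1 : ι → ℤ) a) :
    ∃ ε : ℤ, (ε = 1 ∨ ε = -1) ∧ ∀ w ∈ Z, m w = Pi.single w ε := by
  have hoff : ∀ w ∈ Z, ∀ a, a ≠ w → m w a = 0 := by
    intro w hw a ha
    obtain ⟨v, hv, hvw, hva⟩ : ∃ v ∈ Z, v ≠ w ∧ v ≠ a := by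
      obtain ⟨i, hi, j, hj, u, hu, hij, hiu, hju⟩ := hZ
      grind
    exact ((eq_zero_of_wedge_eq hvw.symm (h w hw v hv hvw.symm)).2 a ha hva.symm).1
  have hprod : ∀ i ∈ Z, ∀ j ∈ Z, i ≠ j → m i i * m j j = 1 := by
    intro i hi j hj hij
    have := (eq_zero_of_wedge_eq hij (h i hi j hj hij)).1
    rwa [hoff i hi j hij.symm, zero_mul, sub_zero] at this
  obtain ⟨i, hi, j, hj, u, hu, hij, hiu, hju⟩ := hZ
  have hdiag : ∀ w ∈ Z, m w w = m i i := by
    intro w hw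
    have key : ∀ v ∈ Z, v ≠ w → v ≠ i → m w w = m i i := fun v hv hvw hvi => by
      have h1 := hprod v hv w hw hvw
      have h2 := hprod v hv i hi hvi
      exact mul_left_cancel₀ (left_ne_zero_of_mul_eq_one h1) (h1.trans h2.symm)
    by_cases hwj : j = w
    · exact key u hu (by rintro rfl; exact hju hwj) hiu.symm
    · exact key j hj hwj hij.symm
  refine ⟨m i i, Int.eq_one_or_neg_one_of_mul_eq_one (hprod i hi j hj hij), fun w hw => ?_⟩
  ext a
  by_cases ha : a = w
  · subst ha; simp [hdiag a hw]
  · simp [ha, hoff w hw a ha]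

end Exponents

/-! ### Products of monomials and the monomial basis. -/

section Monomials

variable {R O Γ : Type*} [Ring R] [Ring O] [Module R O] [IsScalarTower R O O]
  [CommGroupWithZero Γ] {κ : R →*₀ Γ} {n r : ℕ} {q : Matrix (Fin n) (Fin n) R}
  {σ : Fin n → R ≃+* R} {x : Fin n → O}

namespace IsSkewQuantumPolynomialRing

theorem isUnit_or_nonneg (hO : IsSkewQuantumPolynomialRing r q σ x) (t : Exponent n r)
    (i : Fin n) : IsUnit (x i) ∨ 0 ≤ t.1 i :=
  (lt_or_ge (i : ℕ) r).imp (hO.isUnit i) (t.2 i)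

theorem normalizes_var (hO : IsSkewQuantumPolynomialRing r q σ x)
    (hκ : ∀ i a, κ (σ i a) = κ a) (i : Fin n) : Normalizes κ (x i) := by
  refine ⟨σ i, hκ i, fun a z => ?_⟩
  rw [← smul_one_mul a z, ← mul_assoc, hO.mul_coeff, smul_mul_assoc]

theorem qCommute_var (hO : IsSkewQuantumPolynomialRing r q σ x) (i j : Fin n) :
    QCommute κ (x i) (x j) (κ (q i j)) :=
  ⟨hO.param.unit i j, rfl, hO.mul_var j i⟩

theorem normalizes_monomial (hO : IsSkewQuantumPolynomialRing r q σ x)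
    (hκ : ∀ i a, κ (σ i a) = κ a) (t : Exponent n r) : Normalizes κ (monomial x t) := by
  refine Normalizes.list_prod fun y hy => ?_
  obtain ⟨i, rfl⟩ := (List.mem_ofFn' _ _).1 hy
  exact (hO.normalizes_var hκ i).intPow (hO.isUnit_or_nonneg t i)

theorem qCommute_monomial (hO : IsSkewQuantumPolynomialRing r q σ x)
    (hκ : ∀ i a, κ (σ i a) = κ a) (s t : Exponent n r) :
    QCommute κ (monomial x s) (monomial x t) (∏ a, ∏ b, κ (q a b) ^ (s.1 a * t.1 b)) := by
  have hN : ∀ (t : Exponent n r) (i : Fin n), Normalizes κ (intPow (x i) (t.1 i)) := fun t i =>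
    (hO.normalizes_var hκ i).intPow (hO.isUnit_or_nonneg t i)
  refine QCommute.ofFn_prod_left (hN s) fun a => QCommute.ofFn_prod_right (hN t) fun b => ?_
  rw [zpow_mul]
  exact ((hO.qCommute_var a b).intPow_left (hO.normalizes_var hκ a)
    (hO.isUnit_or_nonneg s a)).intPow_right (hO.normalizes_var hκ b) (hO.isUnit_or_nonneg t b)

theorem exists_monomial_mul_monomial (hO : IsSkewQuantumPolynomialRing r q σ x)
    (hκ : ∀ i a, κ (σ i a) = κ a) (s t : Exponent n r) :
    ∃ c : Rˣ, monomial x s * monomial x t = (c : R) • monomial x (s.add t) := by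
  have hN : ∀ (t : Exponent n r) (i : Fin n), Normalizes κ (intPow (x i) (t.1 i)) := fun t i =>
    (hO.normalizes_var hκ i).intPow (hO.isUnit_or_nonneg t i)
  obtain ⟨c, hc⟩ := ofFn_prod_mul_ofFn_prod (hN s) (hN t) fun a b =>
    ((hO.qCommute_var a b).intPow_left (hO.normalizes_var hκ a)
      (hO.isUnit_or_nonneg s a)).intPow_right (hO.normalizes_var hκ b) (hO.isUnit_or_nonneg t b)
  refine ⟨c, hc.trans ?_⟩
  congr 3
  funext i
  refine (intPow_add ?_).symm
  exact (lt_or_ge (i : ℕ) r).imp (hO.isUnit i) fun hi => ⟨s.2 i hi, t.2 i hi⟩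

theorem monomial_eq_intPow {t : Exponent n r} {w : Fin n} {k : ℤ} (ht : t.1 = Pi.single w k) :
    monomial x t = intPow (x w) k := by
  rw [monomial, ofFn_prod_eq_single w, ht, Pi.single_eq_same]
  intro i hi
  simp [ht, hi, intPow]

/-- The basis of monomials. -/
noncomputable def basis (hO : IsSkewQuantumPolynomialRing r q σ x) :
    Module.Basis (Exponent n r) R O :=
  Module.Basis.mk hO.linearIndependent hO.span_eq_top.ge

theorem basis_apply (hO : IsSkewQuantumPolynomialRing r q σ x) (t : Exponent n r) :
    hO.basis t = monomial x t := Module.Basis.mk_apply _ _ t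

end IsSkewQuantumPolynomialRing

end Monomials

/-! ### Leading exponents of q-commuting elements. -/

section LeadingExponents

variable {R O Γ : Type*} [Ring R] [Ring O] [Module R O] [IsScalarTower R O O]
  [CommGroupWithZero Γ] {κ : R →*₀ Γ} {n r : ℕ} {q : Matrix (Fin n) (Fin n) R}
  {σ : Fin n → R ≃+* R} {x : Fin n → O}

/-- `t` is the exponent of the leading monomial of `y`, for the order given by `d`. -/
def IsLeading (hO : IsSkewQuantumPolynomialRing r q σ x) (d : Fin n → ℤ) (y : O)
    (t : Exponent n r) : Prop :=
  hO.basis.repr y t ≠ 0 ∧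
    ∀ t', hO.basis.repr y t' ≠ 0 → Exponent.twistLex d t' ≤ Exponent.twistLex d t

theorem exists_isLeading (hO : IsSkewQuantumPolynomialRing r q σ x) (d : Fin n → ℤ) {y : O}
    (hy : y ≠ 0) : ∃ t, IsLeading hO d y t := by
  obtain ⟨t, ht, hmax⟩ := (hO.basis.repr y).support.exists_max_image (Exponent.twistLex d)
    (Finsupp.support_nonempty_iff.2 (by simpa using hy))
  exact ⟨t, Finsupp.mem_support_iff.1 ht, fun t' ht' => hmax t' (Finsupp.mem_support_iff.2 ht')⟩

/-- The coefficients of `y * z` and `p • (z * y)` at `s + t` are compared. `κ` forgets the twists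
and the order of the factors, so the nonzero leading coefficients cancel and only the commutation
factor of the two monomials is left. -/
theorem prod_zpow_of_isLeading (hO : IsSkewQuantumPolynomialRing r q σ x)
    (hκ : ∀ i a, κ (σ i a) = κ a) (hκ0 : ∀ a, κ a = 0 → a = 0)
    {d : Fin n → ℤ} (hd : ∀ i, d i ≠ 0) {y z : O}
    {s t : Exponent n r} (hs : IsLeading hO d y s) (ht : IsLeading hO d z t) {p : R}
    (hp : y * z = p • (z * y)) :
    ∏ a, ∏ b, κ (q a b) ^ (s.1 a * t.1 b) = κ p := by
  choose τ hτ hτmul using fun t : Exponent n r => hO.normalizes_monomial hκ t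
  choose c hc using fun s t : Exponent n r => hO.exists_monomial_mul_monomial hκ s t
  obtain ⟨w, hw, hcomm⟩ := hO.qCommute_monomial hκ s t
  have hadd : s.add t = t.add s := Subtype.ext (add_comm s.1 t.1)
  have key := fun {y z : O} {s t : Exponent n r} (hs : IsLeading hO d y s)
      (ht : IsLeading hO d z t) =>
    repr_mul_apply_of_isMax hO.basis Exponent.add τ (fun s t => c s t)
      (by simpa [IsSkewQuantumPolynomialRing.basis_apply] using hτmul)
      (by simpa [IsSkewQuantumPolynomialRing.basis_apply] using hc)
      (Exponent.twistLex d) (Exponent.twistLex_injective hd) (Exponent.twistLex_add d)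
      (fun s' hs' => hs.2 s' (Finsupp.mem_support_iff.1 hs'))
      (fun t' ht' => ht.2 t' (Finsupp.mem_support_iff.1 ht'))
  have hcw : (c s t : R) = w * c t s := by
    rw [hc, hc, smul_smul, ← hadd] at hcomm
    simpa [← hO.basis_apply] using congrArg (fun v => hO.basis.repr v (s.add t)) hcomm
  have h1 := key hs ht
  have h2 := key ht hs
  rw [hp, map_smul, Finsupp.smul_apply, smul_eq_mul, hadd, h2, hcw] at h1
  have h3 := congrArg κ h1
  simp only [map_mul, hτ] at h3
  have hy0 : κ (hO.basis.repr y s) ≠ 0 := fun h => hs.1 (hκ0 _ h)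
  have hz0 : κ (hO.basis.repr z t) ≠ 0 := fun h => ht.1 (hκ0 _ h)
  have hc0 : κ (c t s) ≠ 0 := ((c t s).isUnit.map κ).ne_zero
  rw [← hw]
  refine mul_right_cancel₀ (mul_ne_zero (mul_ne_zero hy0 hz0) hc0) ?_
  rw [← mul_assoc, mul_comm (κ w), mul_assoc, ← h3, mul_comm (κ (hO.basis.repr z t))]

/-- The independence of the parameters, for a homomorphism that is nonzero on `R \ {0}`. -/
def IndependentVia (κ : R →*₀ Γ) (q : Matrix (Fin n) (Fin n) R) : Prop :=
  ∀ m : Fin n → Fin n → ℤ,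
    ∏ p : {p : Fin n × Fin n // p.1 < p.2}, κ (q p.1.1 p.1.2) ^ m p.1.1 p.1.2 = 1 →
      ∀ a b, a < b → m a b = 0

theorem prod_zpow_eq_prod_lt (hq : IsParameterMatrix q) (m : Fin n → Fin n → ℤ) :
    ∏ a, ∏ b, κ (q a b) ^ m a b =
      ∏ p : {p : Fin n × Fin n // p.1 < p.2}, κ (q p.1.1 p.1.2) ^ (m p.1.1 p.1.2 - m p.1.2 p.1.1) := by
  have hne : ∀ a b, κ (q a b) ≠ 0 := fun a b =>
    left_ne_zero_of_mul_eq_one (b := κ (q b a)) (by rw [← map_mul, hq.mul_swap, map_one])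
  have hinv : ∀ a b, κ (q b a) = (κ (q a b))⁻¹ := fun a b =>
    eq_inv_of_mul_eq_one_left (by rw [← map_mul, hq.mul_swap, map_one])
  have hdiag : ∀ a, κ (q a a) = 1 := fun a => by rw [hq.diag, map_one]
  have hlt : ∀ f : Fin n × Fin n → Γ, ∏ p : {p : Fin n × Fin n // p.1 < p.2}, f p =
      ∏ p, if p.1 < p.2 then f p else 1 := fun f => by
    rw [← Finset.prod_filter]
    exact (Finset.prod_subtype _ (by simp) f).symm
  have hsplit : ∀ p : Fin n × Fin n, κ (q p.1 p.2) ^ m p.1 p.2 =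
      (if p.1 < p.2 then κ (q p.1 p.2) ^ m p.1 p.2 else 1) *
        if p.2 < p.1 then κ (q p.1 p.2) ^ m p.1 p.2 else 1 := by
    rintro ⟨a, b⟩
    rcases lt_trichotomy a b with h | rfl | h
    · simp [h, h.not_gt]
    · simp [hdiag]
    · simp [h, h.not_gt]
  rw [← Fintype.prod_prod_type' fun a b => κ (q a b) ^ m a b,
    hlt fun p => κ (q p.1 p.2) ^ (m p.1 p.2 - m p.2 p.1), Finset.prod_congr rfl fun p _ => hsplit p,
    Finset.prod_mul_distrib, ← (Equiv.prodComm (Fin n) (Fin n)).prod_comp fun p =>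
      if p.2 < p.1 then κ (q p.1 p.2) ^ m p.1 p.2 else 1, ← Finset.prod_mul_distrib]
  refine Finset.prod_congr rfl fun p _ => ?_
  by_cases h : p.1 < p.2
  · simp [h, hinv p.1 p.2, zpow_sub₀ (hne _ _), div_eq_mul_inv]
  · simp [h]

theorem sub_eq_sub_of_prod_zpow_eq (hq : IsParameterMatrix q) (hind : IndependentVia κ q)
    {m m' : Fin n → Fin n → ℤ}
    (h : ∏ a, ∏ b, κ (q a b) ^ m a b = ∏ a, ∏ b, κ (q a b) ^ m' a b) (a b : Fin n) :
    m a b - m b a = m' a b - m' b a := by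
  have hne : ∀ a b, κ (q a b) ≠ 0 := fun a b =>
    left_ne_zero_of_mul_eq_one (b := κ (q b a)) (by rw [← map_mul, hq.mul_swap, map_one])
  rw [prod_zpow_eq_prod_lt hq, prod_zpow_eq_prod_lt hq] at h
  have key := hind (fun a b => m a b - m b a - (m' a b - m' b a)) (by
    simp only [zpow_sub₀ (hne _ _) (_ - _) (_ - _), Finset.prod_div_distrib]
    rw [h]
    exact div_self (Finset.prod_ne_zero_iff.2 fun p _ => zpow_ne_zero _ (hne _ _)))
  rcases lt_trichotomy a b with hab | rfl | hab
  · have := key a b hab; omega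
  · simp
  · have := key b a hab; omega

theorem wedge_eq_of_isLeading (hO : IsSkewQuantumPolynomialRing r q σ x)
    (hκ : ∀ i a, κ (σ i a) = κ a) (hκ0 : ∀ a, κ a = 0 → a = 0) (hind : IndependentVia κ q)
    {d : Fin n → ℤ} (hd : ∀ i, d i ≠ 0) {y z : O} {s t : Exponent n r}
    (hs : IsLeading hO d y s) (ht : IsLeading hO d z t) {i j : Fin n}
    (hp : y * z = q i j • (z * y)) (a b : Fin n) :
    s.1 a * t.1 b - s.1 b * t.1 a =
      (Pi.single i 1 : Fin n → ℤ) a * (Pi.single j 1 : Fin n → ℤ) b -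
        (Pi.single i 1 : Fin n → ℤ) b * (Pi.single j 1 : Fin n → ℤ) a := by
  refine sub_eq_sub_of_prod_zpow_eq hO.param hind (m := fun a b => s.1 a * t.1 b)
    (m' := fun a b => (Pi.single i 1 : Fin n → ℤ) a * (Pi.single j 1 : Fin n → ℤ) b) ?_ a b
  rw [prod_zpow_of_isLeading hO hκ hκ0 hd hs ht hp, Finset.prod_eq_single i, Finset.prod_eq_single j]
  · simp
  · intro b _ hb; simp [hb]
  · simp
  · intro a _ ha; simp [ha]
  · simp

theorem exists_sign_of_isLeading (hO : IsSkewQuantumPolynomialRing r q σ x)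
    (hκ : ∀ i a, κ (σ i a) = κ a) (hκ0 : ∀ a, κ a = 0 → a = 0) (hind : IndependentVia κ q)
    {d : Fin n → ℤ} (hd : ∀ i, d i ≠ 0) {f : Fin n → O}
    (hf : ∀ i j, f i * f j = q i j • (f j * f i))
    (h3 : ∃ i j u : Fin n, i ≠ j ∧ i ≠ u ∧ j ≠ u ∧ f i ≠ 0 ∧ f j ≠ 0 ∧ f u ≠ 0) :
    ∃ ε : ℤ, (ε = 1 ∨ ε = -1) ∧ ∀ w, f w ≠ 0 →
      ∃ t : Exponent n r, t.1 = Pi.single w ε ∧ IsLeading hO d (f w) t := by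
  classical
  have : ∀ w, ∃ t : Exponent n r, f w ≠ 0 → IsLeading hO d (f w) t := fun w => by
    by_cases hw : f w = 0
    -- A default exponent, never used.
    · exact ⟨⟨0, fun _ _ => le_rfl⟩, fun h => absurd hw h⟩
    · exact (exists_isLeading hO d hw).imp fun t ht _ => ht
  choose m hm using this
  obtain ⟨i, j, u, hij, hiu, hju, hi, hj, hu⟩ := h3
  obtain ⟨ε, hε, h⟩ := exists_sign_of_wedge_eq {w | f w ≠ 0}
    ⟨i, hi, j, hj, u, hu, hij, hiu, hju⟩ (fun w => (m w).1)
    fun i hi j hj _ => wedge_eq_of_isLeading hO hκ hκ0 hind hd (hm i hi) (hm j hj) (hf i j)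
  exact ⟨ε, hε, fun w hw => ⟨m w, h w hw, hm w hw⟩⟩

theorem exists_sign_forall_support (hO : IsSkewQuantumPolynomialRing r q σ x)
    (hκ : ∀ i a, κ (σ i a) = κ a) (hκ0 : ∀ a, κ a = 0 → a = 0) (hind : IndependentVia κ q)
    {f : Fin n → O} (hf : ∀ i j, f i * f j = q i j • (f j * f i))
    (h3 : ∃ i j u : Fin n, i ≠ j ∧ i ≠ u ∧ j ≠ u ∧ f i ≠ 0 ∧ f j ≠ 0 ∧ f u ≠ 0) :
    ∃ ε : ℤ, (ε = 1 ∨ ε = -1) ∧ ∀ w t, hO.basis.repr (f w) t ≠ 0 → t.1 = Pi.single w ε := by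
  have hsign := fun (d : Fin n → ℤ) (hd : ∀ i, d i ≠ 0) =>
    exists_sign_of_isLeading hO hκ hκ0 hind hd hf h3
  obtain ⟨ε, hε, h⟩ := hsign (fun _ => 1) (by simp)
  obtain ⟨ε', hε', h'⟩ := hsign (fun _ => -1) (by simp)
  by_cases heq : ε = ε'
  · subst heq
    refine ⟨ε, hε, fun w t ht => ?_⟩
    have hw : f w ≠ 0 := fun hw => ht (by simp [hw])
    obtain ⟨s, hs, hmax⟩ := h w hw
    obtain ⟨s', hs', hmax'⟩ := h' w hw
    obtain rfl : s' = s := Subtype.ext (hs'.trans hs.symm)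
    rw [← hs]
    -- Negating all signs reverses the order, so `s` is both the largest and the smallest exponent
    -- of `f w`.
    have hneg : ∀ v : Exponent n r, Exponent.twistLex (fun _ => -1) v =
        -Exponent.twistLex (fun _ => 1) v := fun v => by
      refine congrArg toLex (funext fun i => ?_)
      change -1 * v.1 i = -(1 * v.1 i)
      ring
    have h1 := hmax.2 t ht
    have h2 := hmax'.2 t ht
    rw [hneg, hneg, neg_le_neg_iff] at h2
    rw [Exponent.twistLex_injective (by simp) (le_antisymm h1 h2)]
  · exfalso
    have hneg : ε' = -ε := by omega
    obtain ⟨i, j, u, hij, -, -, hi, hj, -⟩ := id h3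
    -- Now every nonzero `f w` contains both `e_w` and `-e_w`. With only coordinate `j` flipped, the
    -- leading sign must be `1` at `i` and `-1` at `j`, yet `δ` is common to both.
    obtain ⟨δ, hδ, h''⟩ := hsign (Function.update (fun _ => 1) j (-1)) fun k => by
      by_cases hk : k = j
      · subst hk; simp
      · simp [hk]
    have key : ∀ w, f w ≠ 0 → 0 ≤ (Function.update (fun _ => 1) j (-1) : Fin n → ℤ) w * δ := by
      intro w hw
      obtain ⟨s, hs, hmax⟩ := h'' w hw
      obtain ⟨t, ht, htne⟩ : ∃ t : Exponent n r, t.1 = Pi.single w (-δ) ∧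
          hO.basis.repr (f w) t ≠ 0 := by
        by_cases hδε : -δ = ε
        · obtain ⟨t, ht, htl⟩ := h w hw
          exact ⟨t, hδε ▸ ht, htl.1⟩
        · obtain ⟨t, ht, htl⟩ := h' w hw
          exact ⟨t, by rw [ht]; congr 1; omega, htl.1⟩
      have := Exponent.le_of_twistLex_le ht hs (hmax.2 t htne)
      linarith
    have h1 := key i hi
    have h2 := key j hj
    simp [hij] at h1 h2
    omega

theorem exists_smul_intPow_of_support (hO : IsSkewQuantumPolynomialRing r q σ x) {y : O}
    {w : Fin n} {ε : ℤ} (h : ∀ t, hO.basis.repr y t ≠ 0 → t.1 = Pi.single w ε) :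
    ∃ c : R, y = c • intPow (x w) ε ∧ (r ≤ (w : ℕ) → ε = -1 → c = 0 ∧ y = 0) := by
  by_cases hy : y = 0
  · exact ⟨0, by simp [hy], fun _ _ => ⟨rfl, hy⟩⟩
  · obtain ⟨t, ht⟩ : ∃ t, hO.basis.repr y t ≠ 0 := by
      by_contra! hall
      exact hy (hO.basis.repr.map_eq_zero_iff.1 (Finsupp.ext hall))
    refine ⟨hO.basis.repr y t, ?_, fun hr hε => ?_⟩
    · rw [← IsSkewQuantumPolynomialRing.monomial_eq_intPow (h t ht), ← hO.basis_apply]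
      apply hO.basis.repr.injective
      ext t'
      by_cases htt : t = t'
      · subst htt; simp
      · have : hO.basis.repr y t' = 0 := by
          by_contra hne
          exact htt (Subtype.ext ((h t ht).trans (h t' hne).symm))
        simp [this, htt]
    -- A nonzero `y` would have an exponent with entry `-1` at a non-invertible variable.
    · have := t.2 w hr
      rw [h t ht, hε] at this
      simp at this

end LeadingExponents

/-! ### The map `κ` given by classes in `(S⁻¹R)ˣ / N`. -/

section FractionClass

variable {R : Type*} [Ring R] [IsDomain R] [OreLocalization.OreSet R⁰] {n : ℕ}

theorem fracMap_fracUnit (σ : R ≃+* R) (a : R⁰) :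
    Units.map (fracMap σ : Frac R →* Frac R) (fracUnit a) = fracUnit (nonzeroMap σ a) := by
  ext
  exact OreLocalization.universalHom_commutes _ _ (fun _ => rfl)

open Classical in
/-- The image of `R` in the abelian group `(S⁻¹R)ˣ / N` with a zero adjoined. -/
noncomputable def fracClass (σ : Fin n → R ≃+* R) : R →*₀ WithZero ((Frac R)ˣ ⧸ fracN σ) where
  toFun a := if h : a = 0 then 0 else
    ((QuotientGroup.mk (fracUnit ⟨a, mem_nonZeroDivisors_of_ne_zero h⟩) :
      (Frac R)ˣ ⧸ fracN σ) : WithZero ((Frac R)ˣ ⧸ fracN σ))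
  map_zero' := by simp
  map_one' := by
    rw [dif_neg one_ne_zero, ← WithZero.coe_one]
    exact congrArg _ (congrArg QuotientGroup.mk (map_one fracUnit))
  map_mul' a b := by
    by_cases ha : a = 0
    · simp [ha]
    by_cases hb : b = 0
    · simp [hb]
    rw [dif_neg ha, dif_neg hb, dif_neg (mul_ne_zero ha hb), ← WithZero.coe_mul]
    exact congrArg _ (congrArg QuotientGroup.mk
      (map_mul fracUnit ⟨a, mem_nonZeroDivisors_of_ne_zero ha⟩
        ⟨b, mem_nonZeroDivisors_of_ne_zero hb⟩))

theorem fracClass_of_ne_zero (σ : Fin n → R ≃+* R) {a : R} (h : a ≠ 0) :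
    fracClass σ a = ((QuotientGroup.mk (fracUnit ⟨a, mem_nonZeroDivisors_of_ne_zero h⟩) :
      (Frac R)ˣ ⧸ fracN σ) : WithZero ((Frac R)ˣ ⧸ fracN σ)) := dif_neg h

theorem eq_zero_of_fracClass_eq_zero (σ : Fin n → R ≃+* R) (a : R) (h : fracClass σ a = 0) :
    a = 0 := by
  by_contra ha
  rw [fracClass_of_ne_zero σ ha] at h
  exact WithZero.coe_ne_zero h

/-- This is why `N` contains the elements `z⁻¹ σ̄ᵢ(z)`. -/
theorem fracClass_apply_equiv (σ : Fin n → R ≃+* R) (i : Fin n) (a : R) :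
    fracClass σ (σ i a) = fracClass σ a := by
  by_cases ha : a = 0
  · simp [ha]
  rw [fracClass_of_ne_zero σ ha, fracClass_of_ne_zero σ ((map_ne_zero_iff _ (σ i).injective).2 ha)]
  refine congrArg _ (QuotientGroup.eq.2 ?_).symm
  refine le_sup_right (a := commutator (Frac R)ˣ)
    (Subgroup.subset_closure ⟨i, fracUnit ⟨a, mem_nonZeroDivisors_of_ne_zero ha⟩, ?_⟩)
  rw [fracMap_fracUnit]
  rfl

theorem fracClass_param {q : Matrix (Fin n) (Fin n) R} (hq : IsParameterMatrix q)
    (σ : Fin n → R ≃+* R) (i j : Fin n) :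
    fracClass σ (q i j) =
      ((paramClass hq σ i j : (Frac R)ˣ ⧸ fracN σ) : WithZero ((Frac R)ˣ ⧸ fracN σ)) := by
  rw [fracClass_of_ne_zero σ (left_ne_zero_of_mul_eq_one (hq.mul_swap i j))]
  refine congrArg _ (congrArg QuotientGroup.mk (Units.ext ?_))
  rfl

theorem ParamsIndependent.independentVia {q : Matrix (Fin n) (Fin n) R}
    {hq : IsParameterMatrix q} {σ : Fin n → R ≃+* R} (h : ParamsIndependent hq σ) :
    IndependentVia (fracClass σ) q := by
  intro m hm a b hab
  simp only [fracClass_param hq] at hm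
  rw [ParamsIndependent, Fintype.linearIndependent_iff] at h
  refine h (fun p => m p.1.1 p.1.2) ?_ ⟨(a, b), hab⟩
  apply Additive.toMul.injective
  apply WithZero.coe_injective
  rw [toMul_sum, toMul_zero, WithZero.coe_one, ← hm]
  simp only [toMul_zsmul, toMul_ofMul, ← WithZero.coe_zpow]
  exact map_prod (WithZero.coeMonoidHom : ((Frac R)ˣ ⧸ fracN σ) →* _) _ _

end FractionClass

end SkewQuantum

theorem mainTheorem9 {R O : Type*} [Ring R] [IsDomain R] [OreLocalization.OreSet (nonZeroDivisors R)]
    [Ring O] [Module R O] [IsScalarTower R O O] {n r : ℕ}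
    (q : Matrix (Fin n) (Fin n) R) (σ : Fin n → R ≃+* R) (x : Fin n → O)
    (hO : SkewQuantum.IsSkewQuantumPolynomialRing r q σ x)
    (hq : SkewQuantum.ParamsIndependent hO.param σ)
    (φ : O →+* O) (hφ : ∀ a : R, φ (a • (1 : O)) = a • (1 : O))
    (h3 : ∃ i j u : Fin n, i ≠ j ∧ i ≠ u ∧ j ≠ u ∧ φ (x i) ≠ 0 ∧ φ (x j) ≠ 0 ∧ φ (x u) ≠ 0) :
    ∃ (c : Fin n → R) (ε : ℤ), (ε = 1 ∨ ε = -1) ∧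
      ∀ w : Fin n, φ (x w) = c w • SkewQuantum.intPow (x w) ε ∧
        (r ≤ (w : ℕ) → ε = -1 → c w = 0 ∧ φ (x w) = 0) := by
  -- Fixing the scalars `a • 1` makes `φ` linear over `R`, so it preserves the relations.
  have hf : ∀ i j, φ (x i) * φ (x j) = q i j • (φ (x j) * φ (x i)) := fun i j => by
    rw [← map_mul, hO.mul_var j i, ← smul_one_mul (q i j) (x j * x i), map_mul, hφ, map_mul,
      smul_one_mul]
  obtain ⟨ε, hε, h⟩ := SkewQuantum.exists_sign_forall_support hO
    (SkewQuantum.fracClass_apply_equiv σ) (SkewQuantum.eq_zero_of_fracClass_eq_zero σ)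
    hq.independentVia hf h3
  choose c hc using fun w => SkewQuantum.exists_smul_intPow_of_support hO (h w)
  exact ⟨c, ε, hε, hc⟩
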